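/- Let $n\ge 2$. Write points of $\mathbb R^{n+1}$ as $x=(x',x_{n+1})$ with $x'\in\mathbb R^n$, and let $S^n_+=\{x\in\mathbb R^{n+1}:|x|=1,\ x_{n+1}\ge 0\}$, with surface measure $d\sigma$. For a real or complex valued $f\in L^1(S^n_+)$, $\theta\in S^{n-1}$ and $t\in(-1,1)$, let $$(V_+f)(\theta,t)=\int_{\{x\in S^n_+:\ x'\cdot\theta=t\}} f\,d\sigma_{\theta,t}$$ be the integral with respect to the induced $(n-1)$-dimensional surface measure, and put $$\varphi(x')=\frac{f\big(x',\sqrt{1-|x'|^2}\big)}{\sqrt{1-|x'|^2}}\ \ (|x'|<1),\qquad \varphi(x')=0\ \ (|x'|\ge 1).$$ For $\psi\in L^1(\mathbb R^n)$ let $(R\psi)(\theta,t)=\int_{x'\cdot\theta=t}\psi$, defined for almost all $(\theta,t)\in S^{n-1}\times\mathbb R$, be its hyperplane Radon transform. Then: 1. $R$ is injective on $L^1(\mathbb R^n)$: if $\psi_1,\psi_2\in L^1(\mathbb R^n)$ and $R\psi_1=R\psi_2$ a.e. on $S^{n-1}\times\mathbb R$, then $\psi_1=\psi_2$ a.e.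 For $\Phi$ that agrees a.e. with $R\psi$ for some $\psi\in L^1(\mathbb R^n)$, write $R^{-1}\Phi=\psi$. 2. For every $f\in L^1(S^n_+)$ one has $\varphi\in L^1(\mathbb R^n)$, and for almost all $(\theta,t)\in S^{n-1}\times(-1,1)$ the integrals defining $(V_+f)(\theta,t)$ and $(R\varphi)(\theta,t)$ converge absolutely and $$(V_+f)(\theta,t)=\sqrt{1-t^2}\,(R\varphi)(\theta,t).$$ If $f$ is continuous on $S^n_+$, this holds for all $(\theta,t)\in S^{n-1}\times(-1,1)$. 3. For every $f\in L^1(S^n_+)$ the function $\Phi(\theta,t)=(1-t^2)^{-1/2}(V_+f)(\theta,t)$ for $|t|<1$, $\Phi(\theta,t)=0$ for $|t|\ge 1$, agrees a.e. on $S^{n-1}\times\mathbb R$ with $R\psi$ for some $\psi\in L^1(\mathbb R^n)$, and $f$ is recovered from $V_+f$ by $$f(x',x_{n+1})=x_{n+1}\,(R^{-1}\Phi)(x')\qquad\text{for } \sigma\text{-almost all } x=(x',x_{n+1})\in S^n_+ .$$ -/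

import Mathlib

open MeasureTheory Set Metric

noncomputable section

namespace VerticalSlice

/-- The Euclidean space `ℝⁿ` of the points `x'`. -/
abbrev E (n : ℕ) : Type := EuclideanSpace ℝ (Fin n)

/-- The Euclidean space `ℝⁿ⁺¹` of the points `x = (x', xₙ₊₁)`: the product `ℝⁿ × ℝ` with the
Euclidean (`ℓ²`) norm.  Here `x' = x.fst` and `xₙ₊₁ = x.snd`. -/
abbrev E' (n : ℕ) : Type := WithLp 2 (E n × ℝ)

/-- The point `(x', s)` of `ℝⁿ⁺¹`. -/
def point {n : ℕ} (x' : E n) (s : ℝ) : E' n := WithLp.toLp 2 (x', s)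

/-- The closed upper half-space `xₙ₊₁ ≥ 0` of `ℝⁿ⁺¹`. -/
def upperHalf (n : ℕ) : Set (E' n) := {x | 0 ≤ x.snd}

/-- The closed upper hemisphere `Sⁿ₊ = {x ∈ Sⁿ : xₙ₊₁ ≥ 0}`. -/
def hemisphere (n : ℕ) : Set (E' n) := sphere 0 1 ∩ upperHalf n

/-- The Riemannian surface measure `dσ` on the hemisphere `Sⁿ₊`, as a measure on `ℝⁿ⁺¹`.
(`volume.toSphere` is the standard surface measure of the unit sphere.) -/
def hemisphereMeasure (n : ℕ) : Measure (E' n) :=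
  (Measure.map (fun ω : sphere (0 : E' n) 1 => (ω : E' n))
    (volume : Measure (E' n)).toSphere).restrict (upperHalf n)

/-- The surface measure, of dimension `n - 1`, on the half-slice `Sⁿ₊ ∩ τ`, where
`τ = {x ∈ Sⁿ : x' · θ = t}`.  For `θ ∈ Sⁿ⁻¹` and `|t| < 1`, `τ` is the sphere of centre `(t θ, 0)`
and radius `r = √(1 - t²)` in the hyperplane `(t θ, 0) + (θᗮ × ℝ)` of `ℝⁿ⁺¹`; its surface measure
is `rⁿ⁻¹` times the image of the surface measure of the unit sphere of the `n`-dimensional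
Euclidean space `θᗮ × ℝ` under the similarity `ω ↦ (t θ, 0) + r ω`.  (For `|t| ≥ 1` and `n ≥ 2`
this is the zero measure.) -/
def sliceMeasure {n : ℕ} (θ : E n) (t : ℝ) : Measure (E' n) :=
  (ENNReal.ofReal (√(1 - t ^ 2) ^ (n - 1)) •
    Measure.map
      (fun ω : sphere (0 : WithLp 2 ((ℝ ∙ θ)ᗮ × ℝ)) 1 =>
        point (t • θ + √(1 - t ^ 2) • (ω.1.fst : E n)) (√(1 - t ^ 2) * ω.1.snd))
      (volume : Measure (WithLp 2 ((ℝ ∙ θ)ᗮ × ℝ))).toSphere).restrict (upperHalf n)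

/-- The surface measure on `Sⁿ⁻¹` times Lebesgue measure on `ℝ`. -/
def cylinderMeasure (n : ℕ) : Measure (sphere (0 : E n) 1 × ℝ) :=
  (volume : Measure (E n)).toSphere.prod volume

variable {𝕜 : Type*} [RCLike 𝕜]

/-- The hemispherical vertical slice transform
`(V₊ f)(θ, t) = ∫_{Sⁿ₊ ∩ τ} f(x) d_τ σ(x)`. -/
def sliceTransform {n : ℕ} (f : E' n → 𝕜) (θ : E n) (t : ℝ) : 𝕜 :=
  ∫ x, f x ∂(sliceMeasure θ t)

/-- The hyperplane Radon transform: the integral of `ψ` over the hyperplane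
`{x' : x' · θ = t} = t θ + θᗮ` with respect to its Lebesgue measure. -/
def radon {n : ℕ} (ψ : E n → 𝕜) (θ : E n) (t : ℝ) : 𝕜 :=
  ∫ y : (ℝ ∙ θ)ᗮ, ψ (t • θ + (y : E n))

open Classical in
/-- The function `φ(x') = f(x', √(1 - |x'|²)) / √(1 - |x'|²)` on the unit ball, extended by zero
to `ℝⁿ`. -/
def flatten {n : ℕ} (f : E' n → 𝕜) (x' : E n) : 𝕜 :=
  if ‖x'‖ < 1 then (√(1 - ‖x'‖ ^ 2))⁻¹ • f (point x' (√(1 - ‖x'‖ ^ 2))) else 0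

open Classical in
/-- The function `Φ(θ, t) = (1 - t²)^{-1/2} (V₊ f)(θ, t)` for `|t| < 1`, extended by zero. -/
def normalizedSlice {n : ℕ} (f : E' n → 𝕜) (θ : E n) (t : ℝ) : 𝕜 :=
  if |t| < 1 then (√(1 - t ^ 2))⁻¹ • sliceTransform f θ t else 0

/-- `ψ ∈ L¹(ℝⁿ)` and `R ψ = Φ` almost everywhere on `Sⁿ⁻¹ × ℝ`. -/
def IsRadonPreimage {n : ℕ} (Φ : E n → ℝ → 𝕜) (ψ : E n → 𝕜) : Prop :=
  Integrable ψ ∧ ∀ᵐ p ∂(cylinderMeasure n), radon ψ (p.1 : E n) p.2 = Φ (p.1 : E n) p.2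

open Classical in
/-- The inverse Radon transform `R⁻¹` of `R` on `L¹(ℝⁿ)`: for `Φ` in the range of `R`, a
representative of the class of all `ψ ∈ L¹(ℝⁿ)` with `R ψ = Φ` almost everywhere. -/
def radonInv {n : ℕ} (Φ : E n → ℝ → 𝕜) : E n → 𝕜 :=
  if h : ∃ ψ, IsRadonPreimage Φ ψ then h.choose else 0

end VerticalSlice

end

/-! Vertical projection carries the surface measure of the upper unit hemisphere to `(1 -
|x|²)^{-1/2} dx` on the unit ball, in every dimension (`toSphere_restrict_upper`). On the hemisphere
of `ℝⁿ⁺¹` this gives `φ ∈ L¹`. The slice at height `t` is a half-sphere of radius `r = √(1 - t²)` in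
a translate of `θᗮ × ℝ`; the same fact over `θᗮ`, rescaled by `r`, turns the slice integral into `r`
times a hyperplane integral of `φ` (`sliceTransform_eq`). Hence `Φ = R φ`, and inversion reduces to
injectivity of `R`. For that, the Fourier slice theorem makes the Fourier transform vanish on almost
every line through the origin, continuity extends this to all of them, and uniqueness of
characteristic functions concludes (`radon_injective`). -/

open MeasureTheory Set Metric

noncomputable section

namespace VerticalSlice

open scoped Pointwise ENNReal

/-! ### Surface measure of the hemisphere in vertical coordinates. -/

section Hemisphere

variable {F : Type*} [NormedAddCommGroup F]

/-- The vertical lift of a point of the unit ball to the upper hemisphere. -/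
def lift (x : F) : WithLp 2 (F × ℝ) := WithLp.toLp 2 (x, √(1 - ‖x‖ ^ 2))

lemma continuous_lift : Continuous (lift : F → WithLp 2 (F × ℝ)) := by
  unfold lift
  exact (WithLp.prod_continuous_toLp 2 F ℝ).comp (by fun_prop)

lemma norm_toLp_sq (u : F) (s : ℝ) : ‖WithLp.toLp 2 (u, s)‖ ^ 2 = ‖u‖ ^ 2 + s ^ 2 := by
  rw [WithLp.prod_norm_sq_eq_of_L2]; simp

variable [InnerProductSpace ℝ F]

/-- `toSphere` measures a set by the volume of the cone over it; this is the cone's explicit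
equation above the equatorial plane. -/
lemma Ioo_smul_cone (A : Set (WithLp 2 (F × ℝ))) (u : F) (s : ℝ) (hs : 0 < s) :
    WithLp.toLp 2 (u, s) ∈ Ioo (0 : ℝ) 1 • (A ∩ {x | 0 ≤ x.snd} ∩ sphere 0 1) ↔
      ‖u‖ ^ 2 + s ^ 2 < 1 ∧ (√(‖u‖ ^ 2 + s ^ 2))⁻¹ • WithLp.toLp 2 (u, s) ∈ A := by
  have hpos : 0 < ‖u‖ ^ 2 + s ^ 2 := by positivity
  have hn : ‖WithLp.toLp 2 (u, s)‖ = √(‖u‖ ^ 2 + s ^ 2) := by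
    rw [← norm_toLp_sq, Real.sqrt_sq (norm_nonneg _)]
  have hrpos := Real.sqrt_pos.2 hpos
  constructor
  · rintro ⟨r, ⟨hr0, hr1⟩, z, ⟨⟨hzA, hz0⟩, hz1⟩, h⟩
    have hz1' : ‖z‖ = 1 := by simpa using hz1
    have h' : r • z = WithLp.toLp 2 (u, s) := h
    have hr : √(‖u‖ ^ 2 + s ^ 2) = r := by
      rw [← hn, ← h', norm_smul, hz1', mul_one, Real.norm_of_nonneg hr0.le]
    rw [hr, ← h', inv_smul_smul₀ hr0.ne']
    refine ⟨?_, hzA⟩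
    rw [Real.sqrt_eq_iff_mul_self_eq hpos.le hr0.le] at hr
    nlinarith
  · rintro ⟨h1, hA⟩
    refine ⟨√(‖u‖ ^ 2 + s ^ 2), ⟨hrpos, (Real.sqrt_lt' one_pos).2 (by simpa using h1)⟩, _,
      ⟨⟨hA, ?_⟩, ?_⟩, smul_inv_smul₀ hrpos.ne' _⟩
    · simp only [mem_ofPred_eq, WithLp.smul_snd, smul_eq_mul]; positivity
    · rw [mem_sphere_zero_iff_norm, norm_smul, hn, norm_inv, Real.norm_of_nonneg hrpos.le,
        inv_mul_cancel₀ hrpos.ne']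

-- With `u` fixed, substitute `s = √(r² - |u|²)`, so that `r` is the norm of `(u, s)`. Normalizing
-- that point gives `lift (r⁻¹ • u)`, and the Jacobian `r / s` is exactly the ball density at `r⁻¹ •
-- u`.
open Classical in
lemma lift_slice_density (A : Set (WithLp 2 (F × ℝ))) (u : F) (r : ℝ) :
    (Ioi ‖u‖).indicator (fun r => ENNReal.ofReal (r / √(r ^ 2 - ‖u‖ ^ 2)) *
      if ‖u‖ ^ 2 + √(r ^ 2 - ‖u‖ ^ 2) ^ 2 < 1 ∧
        (√(‖u‖ ^ 2 + √(r ^ 2 - ‖u‖ ^ 2) ^ 2))⁻¹ • WithLp.toLp 2 (u, √(r ^ 2 - ‖u‖ ^ 2)) ∈ A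
      then 1 else 0) r =
    (Ioo (0 : ℝ) 1).indicator (fun r => (ball (0 : F) 1 ∩ lift ⁻¹' A).indicator
      (fun x => ((√(1 - ‖x‖ ^ 2))⁻¹.toNNReal : ℝ≥0∞)) (r⁻¹ • u)) r := by
  by_cases hr : ‖u‖ < r
  · have hr0 : 0 < r := (norm_nonneg u).trans_lt hr
    have h0 : 0 ≤ r ^ 2 - ‖u‖ ^ 2 := by nlinarith [norm_nonneg u]
    have hnorm : ‖r⁻¹ • u‖ = r⁻¹ * ‖u‖ := by
      rw [norm_smul, Real.norm_of_nonneg (inv_pos.2 hr0).le]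
    have hscale : √(1 - ‖r⁻¹ • u‖ ^ 2) = r⁻¹ * √(r ^ 2 - ‖u‖ ^ 2) := by
      rw [hnorm, show 1 - (r⁻¹ * ‖u‖) ^ 2 = (r⁻¹) ^ 2 * (r ^ 2 - ‖u‖ ^ 2) by field_simp,
        Real.sqrt_mul (sq_nonneg _), Real.sqrt_sq (inv_pos.2 hr0).le]
    have hlift : r⁻¹ • WithLp.toLp 2 (u, √(r ^ 2 - ‖u‖ ^ 2)) = lift (r⁻¹ • u) := by
      rw [lift, hscale]; rfl
    have hball : r⁻¹ • u ∈ ball (0 : F) 1 := by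
      rw [mem_ball_zero_iff, hnorm, inv_mul_lt_one₀ hr0]; exact hr
    rw [indicator_of_mem (show r ∈ Ioi ‖u‖ from hr), Real.sq_sqrt h0, add_sub_cancel,
      Real.sqrt_sq hr0.le, hlift]
    have h1 : r ^ 2 < 1 ↔ r < 1 := by
      rw [sq_lt_one_iff₀ hr0.le]
    by_cases hr1 : r < 1
    · rw [indicator_of_mem (show r ∈ Ioo (0 : ℝ) 1 from ⟨hr0, hr1⟩)]
      by_cases hA : lift (r⁻¹ • u) ∈ A
      · rw [if_pos ⟨h1.2 hr1, hA⟩, indicator_of_mem (show r⁻¹ • u ∈ ball (0 : F) 1 ∩ lift ⁻¹' A from ⟨hball, hA⟩), hscale, mul_one, mul_inv, inv_inv,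
          div_eq_mul_inv]
        rfl
      · rw [if_neg (fun h => hA h.2), indicator_of_notMem (fun h => hA h.2), mul_zero]
    · rw [if_neg (fun h => hr1 (h1.1 h.1)), indicator_of_notMem (fun h => hr1 h.2), mul_zero]
  · rw [indicator_of_notMem (show r ∉ Ioi ‖u‖ from hr), eq_comm]
    by_cases h : r ∈ Ioo (0 : ℝ) 1
    · rw [indicator_of_mem h, indicator_of_notMem]
      rintro ⟨h', -⟩
      rw [mem_ball_zero_iff, norm_smul, Real.norm_of_nonneg (inv_pos.2 h.1).le,
        inv_mul_lt_one₀ h.1] at h'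
      exact hr h'
    · rw [indicator_of_notMem h]

variable [FiniteDimensional ℝ F] [MeasurableSpace F] [BorelSpace F]

/-- The density `(1 - |x|²)^{-1/2}` on the open unit ball. -/
def ballMeasure (F : Type*) [NormedAddCommGroup F] [InnerProductSpace ℝ F] [FiniteDimensional ℝ F]
    [MeasurableSpace F] [BorelSpace F] : Measure F :=
  ((volume : Measure F).restrict (ball 0 1)).withDensity
    fun x => ((√(1 - ‖x‖ ^ 2))⁻¹.toNNReal : ℝ≥0∞)

lemma measurableEmbedding_lift : MeasurableEmbedding (lift : F → WithLp 2 (F × ℝ)) := by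
  refine continuous_lift.measurableEmbedding fun x y h => ?_
  exact congrArg WithLp.fst h

lemma lintegral_Ioi_sqrt_sub_sq (a : ℝ) (ha : 0 ≤ a) (g : ℝ → ℝ≥0∞) :
    ∫⁻ s in Ioi 0, g s =
      ∫⁻ r in Ioi a, ENNReal.ofReal (r / √(r ^ 2 - a ^ 2)) * g √(r ^ 2 - a ^ 2) := by
  have hpos : ∀ r ∈ Ioi a, 0 < r ^ 2 - a ^ 2 := fun r hr => by
    have : a < r := hr
    nlinarith
  have him : (fun r : ℝ => √(r ^ 2 - a ^ 2)) '' Ioi a = Ioi 0 := by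
    ext s
    constructor
    · rintro ⟨r, hr, rfl⟩
      exact Real.sqrt_pos.2 (hpos r hr)
    · intro hs
      have hs : 0 < s := hs
      refine ⟨√(s ^ 2 + a ^ 2), Real.lt_sqrt_of_sq_lt (by nlinarith), ?_⟩
      simp only
      rw [Real.sq_sqrt (by positivity), add_sub_cancel_right, Real.sqrt_sq hs.le]
  have hd : ∀ r ∈ Ioi a, HasDerivWithinAt (fun r : ℝ => √(r ^ 2 - a ^ 2))
      (r / √(r ^ 2 - a ^ 2)) (Ioi a) r := fun r hr => by
    have h : HasDerivAt (fun r : ℝ => r ^ 2 - a ^ 2) (2 * r) r := by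
      simpa using (hasDerivAt_pow 2 r).sub_const (a ^ 2)
    exact ((h.sqrt (hpos r hr).ne').congr_deriv
      (mul_div_mul_left _ _ two_ne_zero)).hasDerivWithinAt
  have hinj : InjOn (fun r : ℝ => √(r ^ 2 - a ^ 2)) (Ioi a) := fun x hx y hy h => by
    have hx' : a < x := hx
    have hy' : a < y := hy
    have := (Real.sqrt_inj (hpos x hx).le (hpos y hy).le).1 h
    nlinarith
  rw [← him, lintegral_image_eq_lintegral_abs_deriv_mul measurableSet_Ioi hd hinj]
  refine setLIntegral_congr_fun measurableSet_Ioi fun r hr => ?_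
  have hr' : a < r := hr
  rw [abs_of_nonneg (div_nonneg (by linarith) (Real.sqrt_nonneg _))]

lemma lintegral_comp_smul (k : F → ℝ≥0∞) {r : ℝ} (hr : r ≠ 0) (hk : Measurable k) :
    ∫⁻ u, k (r • u) = ENNReal.ofReal |(r ^ Module.finrank ℝ F)⁻¹| * ∫⁻ x, k x := by
  rw [← lintegral_map hk (measurable_const_smul r), Measure.map_addHaar_smul _ hr,
    lintegral_smul_measure, smul_eq_mul]

/-- After swapping the integrals, dilation contributes `r ^ d` with `d = finrank ℝ F`, and `∫₀¹ r ^
d = 1 / (d + 1)`. This constant later cancels the dimension factor built into `toSphere`. -/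
lemma lintegral_Ioo_scale (k : F → ℝ≥0∞) (hk : Measurable k) :
    ∫⁻ u, ∫⁻ r in Ioo (0 : ℝ) 1, k (r⁻¹ • u) =
      ENNReal.ofReal (Module.finrank ℝ F + 1 : ℝ)⁻¹ * ∫⁻ x, k x := by
  rw [lintegral_lintegral_swap (by fun_prop)]
  have h1 : ∀ r ∈ Ioo (0 : ℝ) 1, ∫⁻ u : F, k (r⁻¹ • u) =
      ENNReal.ofReal (r ^ Module.finrank ℝ F) * ∫⁻ x, k x := by
    intro r hr
    rw [lintegral_comp_smul _ (inv_pos.2 hr.1).ne' hk, inv_pow, inv_inv,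
      abs_of_nonneg (pow_nonneg hr.1.le _)]
  rw [setLIntegral_congr_fun measurableSet_Ioo h1, lintegral_mul_const _ (by fun_prop)]
  congr 1
  rw [← ofReal_integral_eq_lintegral_ofReal]
  · rw [← integral_Ioc_eq_integral_Ioo, ← intervalIntegral.integral_of_le zero_le_one,
      integral_pow]
    simp
  · exact ((continuous_pow _).integrableOn_Icc).mono_set Ioo_subset_Icc_self
  · filter_upwards [ae_restrict_mem measurableSet_Ioo] with r hr
    exact pow_nonneg hr.1.le _

lemma ballMeasure_preimage_lift {A : Set (WithLp 2 (F × ℝ))} (hA : MeasurableSet A) :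
    ballMeasure F (lift ⁻¹' A) = ∫⁻ x, (ball (0 : F) 1 ∩ lift ⁻¹' A).indicator
      (fun x => ((√(1 - ‖x‖ ^ 2))⁻¹.toNNReal : ℝ≥0∞)) x := by
  have hm := continuous_lift.measurable hA
  rw [ballMeasure, withDensity_apply _ hm, Measure.restrict_restrict hm,
    lintegral_indicator (measurableSet_ball.inter hm), inter_comm]

lemma volume_cone {A : Set (WithLp 2 (F × ℝ))} (hA : MeasurableSet A) :
    volume (Ioo (0 : ℝ) 1 • (A ∩ {x | 0 ≤ x.snd} ∩ sphere 0 1)) =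
      ENNReal.ofReal (Module.finrank ℝ F + 1 : ℝ)⁻¹ * ballMeasure F (lift ⁻¹' A) := by
  classical
  let D : Set (F × ℝ) := {p | 0 < p.2 ∧ ‖p.1‖ ^ 2 + p.2 ^ 2 < 1 ∧
    (√(‖p.1‖ ^ 2 + p.2 ^ 2))⁻¹ • WithLp.toLp 2 p ∈ A}
  have htoLp : Measurable (WithLp.toLp 2 : F × ℝ → WithLp 2 (F × ℝ)) :=
    (WithLp.prod_continuous_toLp 2 F ℝ).measurable
  have hD : MeasurableSet D := by
    have h1 : MeasurableSet {p : F × ℝ | ‖p.1‖ ^ 2 + p.2 ^ 2 < 1} :=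
      measurableSet_lt (by fun_prop) measurable_const
    refine (measurableSet_lt measurable_const measurable_snd).inter (h1.inter ?_)
    exact (Measurable.smul (f := fun p : F × ℝ => (√(‖p.1‖ ^ 2 + p.2 ^ 2))⁻¹) (by fun_prop)
      htoLp) hA
  have hvol : volume (Ioo (0 : ℝ) 1 • (A ∩ {x : WithLp 2 (F × ℝ) | 0 ≤ x.snd} ∩ sphere 0 1)) =
      volume D := by
    have hemb : MeasurableEmbedding (WithLp.toLp 2 : F × ℝ → WithLp 2 (F × ℝ)) :=
      (MeasurableEquiv.toLp 2 (F × ℝ)).measurableEmbedding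
    rw [← (WithLp.volume_preserving_toLp (U := F) (V := ℝ)).measure_preimage_emb hemb]
    refine measure_congr ?_
    -- The cone may meet the plane `s = 0`, which `D` excludes; that plane is null.
    have h0 : ∀ᵐ p : F × ℝ, p.2 ≠ 0 :=
      Measure.quasiMeasurePreserving_snd.ae (Measure.ae_ne volume (0 : ℝ))
    filter_upwards [h0] with p hp
    refine propext ?_
    rcases lt_or_gt_of_ne hp with h | h
    · refine ⟨?_, fun h' => absurd h'.1 h.not_gt⟩
      rintro ⟨r, hr, z, ⟨⟨-, hz⟩, -⟩, hrz⟩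
      have : p.2 = r * z.snd := (congrArg WithLp.snd hrz).symm
      exact absurd (this ▸ mul_nonneg hr.1.le hz) h.not_ge
    · exact (Ioo_smul_cone A p.1 p.2 h).trans ⟨fun h' => ⟨h, h'⟩, fun h' => h'.2⟩
  rw [hvol, Measure.volume_eq_prod, Measure.prod_apply hD, ballMeasure_preimage_lift hA,
    ← lintegral_Ioo_scale]
  · refine lintegral_congr fun u => ?_
    have hDm : MeasurableSet (Prod.mk u ⁻¹' D) := measurable_prodMk_left hD
    rw [← lintegral_indicator_one hDm, ← lintegral_indicator measurableSet_Ioo]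
    simp_rw [← lift_slice_density]
    rw [lintegral_indicator measurableSet_Ioi,
      ← lintegral_Ioi_sqrt_sub_sq ‖u‖ (norm_nonneg u) (fun s =>
        if ‖u‖ ^ 2 + s ^ 2 < 1 ∧ (√(‖u‖ ^ 2 + s ^ 2))⁻¹ • WithLp.toLp 2 (u, s) ∈ A then 1 else 0),
      ← lintegral_indicator measurableSet_Ioi]
    refine lintegral_congr fun s => ?_
    by_cases hs : 0 < s
    · simp [indicator, D, hs]
    · simp [indicator, D, hs]
  · exact Measurable.indicator (by fun_prop)
      (measurableSet_ball.inter (continuous_lift.measurable hA))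

/-- In the coordinates of its vertical projection, the surface measure of the upper hemisphere
has density `(1 - |x|²)^{-1/2}` on the unit ball. -/
theorem toSphere_restrict_upper :
    (Measure.map (fun ω : sphere (0 : WithLp 2 (F × ℝ)) 1 => (ω : WithLp 2 (F × ℝ)))
      (volume : Measure (WithLp 2 (F × ℝ))).toSphere).restrict {x | 0 ≤ x.snd} =
    Measure.map lift (ballMeasure F) := by
  have hU : MeasurableSet {x : WithLp 2 (F × ℝ) | 0 ≤ x.snd} :=
    (isClosed_le continuous_const (WithLp.continuous_snd 2 F ℝ)).measurableSet
  ext A hA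
  have hdim : Module.finrank ℝ (WithLp 2 (F × ℝ)) = Module.finrank ℝ F + 1 := by
    rw [LinearEquiv.finrank_eq (WithLp.linearEquiv 2 ℝ (F × ℝ)), Module.finrank_prod,
      Module.finrank_self]
  rw [Measure.restrict_apply hA, Measure.map_apply measurable_subtype_coe (hA.inter hU),
    Measure.toSphere_apply' _ (measurable_subtype_coe (hA.inter hU)),
    Measure.map_apply continuous_lift.measurable hA, Subtype.image_preimage_coe,
    inter_comm (sphere _ _), volume_cone hA, ← mul_assoc, hdim, ← ENNReal.ofReal_natCast,
    ← ENNReal.ofReal_mul (by positivity)]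
  have : ((Module.finrank ℝ F + 1 : ℕ) : ℝ) * (Module.finrank ℝ F + 1 : ℝ)⁻¹ = 1 := by
    push_cast
    exact mul_inv_cancel₀ (by positivity)
  rw [this, ENNReal.ofReal_one, one_mul]

end Hemisphere

variable {𝕜 : Type*} [RCLike 𝕜]

/-! ### Integrals against the ball density. -/

section Projection

variable {F : Type*} [NormedAddCommGroup F]

open Classical in
lemma ite_ball_eq_indicator (h : F → 𝕜) :
    (fun x => if ‖x‖ < 1 then (√(1 - ‖x‖ ^ 2))⁻¹ • h x else 0) =
      (ball (0 : F) 1).indicator fun x => (√(1 - ‖x‖ ^ 2))⁻¹.toNNReal • h x := by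
  ext x
  by_cases hx : ‖x‖ < 1
  · rw [if_pos hx, indicator_of_mem (mem_ball_zero_iff.2 hx), NNReal.smul_def,
      Real.coe_toNNReal _ (inv_nonneg.2 (Real.sqrt_nonneg _))]
  · rw [if_neg hx, indicator_of_notMem (fun h => hx (mem_ball_zero_iff.1 h))]

variable [InnerProductSpace ℝ F] [FiniteDimensional ℝ F] [MeasurableSpace F] [BorelSpace F]

open Classical in
lemma integrable_ballMeasure_iff (h : F → 𝕜) :
    Integrable h (ballMeasure F) ↔
      Integrable fun x => if ‖x‖ < 1 then (√(1 - ‖x‖ ^ 2))⁻¹ • h x else 0 := by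
  rw [ite_ball_eq_indicator, integrable_indicator_iff measurableSet_ball, ballMeasure,
    integrable_withDensity_iff_integrable_smul (by fun_prop), IntegrableOn]

open Classical in
lemma integral_ballMeasure (h : F → 𝕜) :
    ∫ x, h x ∂(ballMeasure F) =
      ∫ x, if ‖x‖ < 1 then (√(1 - ‖x‖ ^ 2))⁻¹ • h x else 0 := by
  rw [ite_ball_eq_indicator, integral_indicator measurableSet_ball, ballMeasure,
    integral_withDensity_eq_integral_smul (by fun_prop)]

end Projection

lemma hemisphereMeasure_eq (n : ℕ) :
    hemisphereMeasure n = Measure.map lift (ballMeasure (E n)) :=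
  toSphere_restrict_upper

lemma lift_eq_point {n : ℕ} (x : E n) : lift x = point x (√(1 - ‖x‖ ^ 2)) := rfl

lemma integrable_flatten_iff {n : ℕ} (f : E' n → 𝕜) :
    Integrable (flatten f) ↔ Integrable f (hemisphereMeasure n) := by
  rw [hemisphereMeasure_eq, measurableEmbedding_lift.integrable_map_iff,
    integrable_ballMeasure_iff]
  rfl

/-! ### Slices of the hemisphere as weighted hyperplanes. -/

section Slice

variable {n : ℕ} {θ : E n}

lemma norm_smul_add_sq (hθ : ‖θ‖ = 1) (t : ℝ) (y : (ℝ ∙ θ)ᗮ) :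
    ‖t • θ + (y : E n)‖ ^ 2 = t ^ 2 + ‖y‖ ^ 2 := by
  have h : inner ℝ (t • θ) (y : E n) = 0 :=
    Submodule.inner_right_of_mem_orthogonal
      (Submodule.smul_mem _ t (Submodule.mem_span_singleton_self θ)) y.2
  rw [norm_add_sq_real, h, norm_smul, hθ]
  simp

lemma finrank_orthogonal (hθ : ‖θ‖ = 1) : Module.finrank ℝ (ℝ ∙ θ)ᗮ = n - 1 := by
  have h := Submodule.finrank_add_finrank_orthogonal (ℝ ∙ θ)
  rw [finrank_span_singleton (norm_ne_zero_iff.1 (hθ ▸ one_ne_zero)),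
    finrank_euclideanSpace_fin] at h
  omega

lemma one_sub_sq_pos {t : ℝ} (ht : |t| < 1) : 0 < 1 - t ^ 2 := by
  have := (sq_lt_one_iff_abs_lt_one t).2 ht
  linarith

lemma sqrt_one_sub_scaled (hθ : ‖θ‖ = 1) {t : ℝ} (ht : |t| < 1) (y : (ℝ ∙ θ)ᗮ) :
    √(1 - ‖t • θ + ((√(1 - t ^ 2) • y : (ℝ ∙ θ)ᗮ) : E n)‖ ^ 2) =
      √(1 - t ^ 2) * √(1 - ‖y‖ ^ 2) := by
  have h0 := (one_sub_sq_pos ht).le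
  rw [norm_smul_add_sq hθ, norm_smul, Real.norm_of_nonneg (Real.sqrt_nonneg _), mul_pow,
    Real.sq_sqrt h0, ← Real.sqrt_mul h0]
  congr 1
  ring

/-- The upward lift of the hyperplane `x' · θ = t`, rescaled to unit radius. -/
def sliceLift (θ : E n) (t : ℝ) (y : (ℝ ∙ θ)ᗮ) : E' n :=
  lift (t • θ + ((√(1 - t ^ 2) • y : (ℝ ∙ θ)ᗮ) : E n))

lemma measurableEmbedding_sliceLift {t : ℝ} (ht : |t| < 1) :
    MeasurableEmbedding (sliceLift θ t) := by
  refine Continuous.measurableEmbedding (continuous_lift.comp (by fun_prop)) fun x y h => ?_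
  have h1 : t • θ + ((√(1 - t ^ 2) • x : (ℝ ∙ θ)ᗮ) : E n) =
      t • θ + ((√(1 - t ^ 2) • y : (ℝ ∙ θ)ᗮ) : E n) := congrArg WithLp.fst h
  exact smul_right_injective _ (Real.sqrt_pos.2 (one_sub_sq_pos ht)).ne'
    (Subtype.coe_injective (add_left_cancel h1))

/-- `toSphere_restrict_upper` is applied with `θᗮ` as base space. The similarity of ratio `√(1 -
t²)` preserves the upper half and, by `sqrt_one_sub_scaled`, takes lifts to lifts. -/
lemma sliceMeasure_eq (hθ : ‖θ‖ = 1) {t : ℝ} (ht : |t| < 1) :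
    sliceMeasure θ t = ENNReal.ofReal (√(1 - t ^ 2) ^ (n - 1)) •
      Measure.map (sliceLift θ t) (ballMeasure (ℝ ∙ θ)ᗮ) := by
  have hr := Real.sqrt_pos.2 (one_sub_sq_pos ht)
  let g : WithLp 2 ((ℝ ∙ θ)ᗮ × ℝ) → E' n := fun x =>
    point (t • θ + √(1 - t ^ 2) • (x.fst : E n)) (√(1 - t ^ 2) * x.snd)
  have hg : Measurable g := by
    refine (WithLp.prod_continuous_toLp 2 (E n) ℝ).measurable.comp ?_
    have h1 : Measurable fun x : WithLp 2 ((ℝ ∙ θ)ᗮ × ℝ) => x.fst :=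
      (WithLp.continuous_fst 2 _ _).measurable
    have h2 : Measurable fun x : WithLp 2 ((ℝ ∙ θ)ᗮ × ℝ) => x.snd :=
      (WithLp.continuous_snd 2 _ _).measurable
    fun_prop
  have hU : MeasurableSet (upperHalf n) :=
    (isClosed_le continuous_const (WithLp.continuous_snd 2 (E n) ℝ)).measurableSet
  have hgU : g ⁻¹' upperHalf n = {x | 0 ≤ x.snd} := by
    ext x
    exact mul_nonneg_iff_of_pos_left hr
  rw [sliceMeasure, Measure.restrict_smul]
  congr 1
  have hmap : (fun ω : sphere (0 : WithLp 2 ((ℝ ∙ θ)ᗮ × ℝ)) 1 =>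
      point (t • θ + √(1 - t ^ 2) • (ω.1.fst : E n)) (√(1 - t ^ 2) * ω.1.snd)) =
      g ∘ Subtype.val := rfl
  rw [hmap, ← Measure.map_map hg measurable_subtype_coe, Measure.restrict_map hg hU, hgU,
    toSphere_restrict_upper, Measure.map_map hg continuous_lift.measurable]
  congr 1
  ext1 y
  rw [sliceLift, lift_eq_point, sqrt_one_sub_scaled hθ ht]
  rfl

/-- The height over the rescaled point is `√(1 - t²)` times the height over `y`; this ratio is the
source of the weight in `V₊ f = √(1 - t²) R φ`. -/
lemma ite_sliceLift (f : E' n → 𝕜) (hθ : ‖θ‖ = 1) {t : ℝ} (ht : |t| < 1) (y : (ℝ ∙ θ)ᗮ)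
    [Decidable (‖y‖ < 1)] :
    (if ‖y‖ < 1 then (√(1 - ‖y‖ ^ 2))⁻¹ • f (sliceLift θ t y) else 0) =
      √(1 - t ^ 2) • flatten f (t • θ + ((√(1 - t ^ 2) • y : (ℝ ∙ θ)ᗮ) : E n)) := by
  have h0 := one_sub_sq_pos ht
  have hr := Real.sqrt_pos.2 h0
  have hiff : ‖t • θ + ((√(1 - t ^ 2) • y : (ℝ ∙ θ)ᗮ) : E n)‖ < 1 ↔ ‖y‖ < 1 := by
    rw [← sq_lt_one_iff₀ (norm_nonneg _), ← sq_lt_one_iff₀ (norm_nonneg y),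
      norm_smul_add_sq hθ, norm_smul, Real.norm_of_nonneg hr.le, mul_pow, Real.sq_sqrt h0.le]
    constructor <;> intro h <;> nlinarith
  unfold flatten
  by_cases hy : ‖y‖ < 1
  · rw [if_pos hy, if_pos (hiff.2 hy), sqrt_one_sub_scaled hθ ht, smul_smul, mul_inv,
      mul_inv_cancel_left₀ hr.ne', sliceLift, lift_eq_point, sqrt_one_sub_scaled hθ ht]
  · rw [if_neg hy, if_neg (fun h => hy (hiff.1 h)), smul_zero]

lemma integrable_sliceMeasure_iff (f : E' n → 𝕜) (hθ : ‖θ‖ = 1) {t : ℝ} (ht : |t| < 1) :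
    Integrable f (sliceMeasure θ t) ↔
      Integrable fun y : (ℝ ∙ θ)ᗮ => flatten f (t • θ + (y : E n)) := by
  classical
  have hr := Real.sqrt_pos.2 (one_sub_sq_pos ht)
  rw [sliceMeasure_eq hθ ht, integrable_smul_measure
    (ENNReal.ofReal_pos.2 (pow_pos hr _)).ne' ENNReal.ofReal_ne_top,
    (measurableEmbedding_sliceLift ht).integrable_map_iff, integrable_ballMeasure_iff]
  simp only [Function.comp_apply, ite_sliceLift f hθ ht]
  rw [← integrable_comp_smul_iff volume (fun y : (ℝ ∙ θ)ᗮ => flatten f (t • θ + (y : E n))) hr.ne']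
  exact integrable_smul_iff hr.ne' _

/-- On every slice the vertical slice transform is the weighted Radon transform of the
flattened function. -/
theorem sliceTransform_eq (f : E' n → 𝕜) (hθ : ‖θ‖ = 1) {t : ℝ} (ht : |t| < 1) :
    sliceTransform f θ t = √(1 - t ^ 2) • radon (flatten f) θ t := by
  classical
  have hr := Real.sqrt_pos.2 (one_sub_sq_pos ht)
  rw [sliceTransform, sliceMeasure_eq hθ ht, integral_smul_measure,
    (measurableEmbedding_sliceLift ht).integral_map, integral_ballMeasure]
  simp only [ite_sliceLift f hθ ht]
  -- The Jacobian of `y ↦ √(1 - t²) • y` on the `(n - 1)`-dimensional `θᗮ` cancels the factor `√(1 -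
  -- t²) ^ (n - 1)` of the slice measure.
  rw [integral_smul,
    Measure.integral_comp_smul volume (fun y : (ℝ ∙ θ)ᗮ => flatten f (t • θ + (y : E n))),
    finrank_orthogonal hθ, ENNReal.toReal_ofReal (pow_nonneg hr.le _), abs_inv,
    abs_of_nonneg (pow_nonneg hr.le _), smul_comm, smul_inv_smul₀ (pow_pos hr _).ne']
  rfl

/-- Such a hyperplane misses the open unit ball. -/
lemma radon_flatten_eq_zero (f : E' n → 𝕜) (hθ : ‖θ‖ = 1) {t : ℝ} (ht : ¬ |t| < 1) :
    radon (flatten f) θ t = 0 := by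
  have h : ∀ y : (ℝ ∙ θ)ᗮ, flatten f (t • θ + (y : E n)) = 0 := fun y => by
    refine if_neg fun h => ht ?_
    rw [← sq_lt_one_iff₀ (norm_nonneg _), norm_smul_add_sq hθ] at h
    exact (sq_lt_one_iff_abs_lt_one t).1 (by nlinarith [norm_nonneg y])
  simp [radon, h]

lemma normalizedSlice_eq (f : E' n → 𝕜) (hθ : ‖θ‖ = 1) (t : ℝ) :
    normalizedSlice f θ t = radon (flatten f) θ t := by
  by_cases ht : |t| < 1
  · rw [normalizedSlice, if_pos ht, sliceTransform_eq f hθ ht,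
      inv_smul_smul₀ (Real.sqrt_pos.2 (one_sub_sq_pos ht)).ne']
  · rw [normalizedSlice, if_neg ht, radon_flatten_eq_zero f hθ ht]

/-- The slice measure is finite and carried by the compact hemisphere. -/
lemma integrable_sliceMeasure_of_continuousOn {f : E' n → 𝕜} (hf : ContinuousOn f (hemisphere n))
    (hθ : ‖θ‖ = 1) {t : ℝ} (ht : |t| < 1) : Integrable f (sliceMeasure θ t) := by
  have hcl : IsClosed (upperHalf n) :=
    isClosed_le continuous_const (WithLp.continuous_snd 2 (E n) ℝ)
  have hcomp : IsCompact (hemisphere n) := (isCompact_sphere _ _).inter_right hcl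
  have hfin : IsFiniteMeasure (sliceMeasure θ t) := by
    unfold sliceMeasure
    have := Measure.smul_finite (Measure.map (fun ω : sphere (0 : WithLp 2 ((ℝ ∙ θ)ᗮ × ℝ)) 1 =>
        point (t • θ + √(1 - t ^ 2) • (ω.1.fst : E n)) (√(1 - t ^ 2) * ω.1.snd))
      (volume : Measure (WithLp 2 ((ℝ ∙ θ)ᗮ × ℝ))).toSphere)
      (ENNReal.ofReal_ne_top (r := √(1 - t ^ 2) ^ (n - 1)))
    infer_instance
  have hmem : ∀ᵐ x ∂(sliceMeasure θ t), x ∈ hemisphere n := by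
    rw [sliceMeasure_eq hθ ht]
    refine Measure.ae_smul_measure ?_ _
    rw [(measurableEmbedding_sliceLift ht).ae_map_iff, ballMeasure]
    refine (withDensity_absolutelyContinuous _ _).ae_le ?_
    filter_upwards [ae_restrict_mem measurableSet_ball] with y hy
    have hy1 : ‖y‖ < 1 := mem_ball_zero_iff.1 hy
    refine ⟨?_, Real.sqrt_nonneg _⟩
    rw [mem_sphere_zero_iff_norm, ← sq_eq_sq₀ (norm_nonneg _) zero_le_one, sliceLift, lift,
      norm_toLp_sq, Real.sq_sqrt, add_sub_cancel, one_pow]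
    rw [norm_smul_add_sq hθ, norm_smul, Real.norm_of_nonneg (Real.sqrt_nonneg _), mul_pow,
      Real.sq_sqrt (one_sub_sq_pos ht).le]
    have := one_sub_sq_pos ht
    have : ‖y‖ ^ 2 < 1 := (sq_lt_one_iff₀ (norm_nonneg y)).2 hy1
    nlinarith
  rw [← Measure.restrict_eq_self_of_ae_mem hmem]
  exact hf.integrableOn_of_subset_isCompact hcomp hcomp.measurableSet subset_rfl
    (measure_ne_top _ _)

end Slice

/-! ### Fubini over hyperplanes and almost every hyperplane. -/

section Fubini

variable {n : ℕ} {θ : E n}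

/-- The orthogonal decomposition `(t, y) ↦ t θ + y` of `ℝⁿ` along a unit vector `θ`. -/
def hyperplaneCoord (θ : E n) (p : ℝ × (ℝ ∙ θ)ᗮ) : E n := p.1 • θ + (p.2 : E n)

lemma measurePreserving_hyperplaneCoord (hθ : ‖θ‖ = 1) :
    MeasurePreserving (hyperplaneCoord θ) := by
  have h1 : MeasurePreserving (LinearIsometryEquiv.toSpanUnitSingleton (𝕜 := ℝ) θ hθ) :=
    LinearIsometryEquiv.measurePreserving _
  have h2 := h1.prod (MeasurePreserving.id (volume : Measure (ℝ ∙ θ)ᗮ))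
  have h3 := (LinearIsometryEquiv.measurePreserving
    (ℝ ∙ θ).orthogonalDecomposition.symm).comp
    ((WithLp.volume_preserving_toLp (U := (ℝ ∙ θ)) (V := (ℝ ∙ θ)ᗮ)).comp h2)
  have h4 : hyperplaneCoord θ = (ℝ ∙ θ).orthogonalDecomposition.symm ∘ WithLp.toLp 2 ∘
      Prod.map (LinearIsometryEquiv.toSpanUnitSingleton (𝕜 := ℝ) θ hθ) id := by
    ext1 p
    simp [hyperplaneCoord, Prod.map]
  rw [h4]
  exact h3

lemma inner_hyperplaneCoord (hθ : ‖θ‖ = 1) (p : ℝ × (ℝ ∙ θ)ᗮ) :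
    inner ℝ θ (hyperplaneCoord θ p) = p.1 := by
  have h : inner ℝ θ (p.2 : E n) = 0 :=
    Submodule.inner_right_of_mem_orthogonal (Submodule.mem_span_singleton_self θ) p.2.2
  rw [hyperplaneCoord, inner_add_right, h, inner_smul_right, real_inner_self_eq_norm_sq, hθ]
  simp

lemma measurableEmbedding_hyperplaneCoord (hθ : ‖θ‖ = 1) :
    MeasurableEmbedding (hyperplaneCoord θ) := by
  refine Continuous.measurableEmbedding (by unfold hyperplaneCoord; fun_prop) fun p q h => ?_
  have h1 : p.1 = q.1 := by
    rw [← inner_hyperplaneCoord hθ p, h, inner_hyperplaneCoord hθ q]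
  refine Prod.ext h1 (Subtype.coe_injective ?_)
  simpa [hyperplaneCoord, h1] using h

lemma lintegral_hyperplanes (hθ : ‖θ‖ = 1) {g : E n → ℝ≥0∞} (hg : Measurable g) :
    ∫⁻ t : ℝ, ∫⁻ y : (ℝ ∙ θ)ᗮ, g (t • θ + (y : E n)) = ∫⁻ x, g x := by
  have hm := measurePreserving_hyperplaneCoord hθ
  rw [← hm.lintegral_comp hg, Measure.volume_eq_prod,
    lintegral_prod (fun p => g (hyperplaneCoord θ p)) (hg.comp hm.measurable).aemeasurable]
  rfl

/-- An integral over a hyperplane `x' · θ = t` as an integral over a domain that does not depend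
on `θ`. -/
lemma lintegral_hyperplane_eq (hθ : ‖θ‖ = 1) (t : ℝ) {g : E n → ℝ≥0∞} (hg : Measurable g) :
    ∫⁻ y : (ℝ ∙ θ)ᗮ, g (t • θ + (y : E n)) =
      ∫⁻ z : E n, (Ioc (0 : ℝ) 1).indicator 1 (inner ℝ θ z) *
        g (t • θ + (z - inner ℝ θ z • θ)) := by
  have hi : Measurable ((Ioc (0 : ℝ) 1).indicator (1 : ℝ → ℝ≥0∞)) :=
    measurable_one.indicator measurableSet_Ioc
  -- The integrand depends only on the component of `z` orthogonal to `θ`, and the slab `0 < ⟨θ, z⟩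
  -- ≤ 1` has thickness one.
  rw [← lintegral_hyperplanes hθ (by fun_prop)]
  have h : ∀ s : ℝ, ∀ y : (ℝ ∙ θ)ᗮ, inner ℝ θ (s • θ + (y : E n)) = s := fun s y =>
    inner_hyperplaneCoord hθ (s, y)
  simp_rw [h, add_sub_cancel_left]
  simp_rw [lintegral_const_mul _
    (show Measurable fun y : (ℝ ∙ θ)ᗮ => g (t • θ + (y : E n)) by fun_prop)]
  rw [lintegral_mul_const _ hi, lintegral_indicator_one measurableSet_Ioc]
  simp

/-- The type `(ℝ ∙ θ)ᗮ` varies with `θ`, so measurability is read off from the slab form, an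
integral over a fixed space. -/
lemma measurable_lintegral_hyperplane {g : E n → ℝ≥0∞} (hg : Measurable g) :
    Measurable fun p : sphere (0 : E n) 1 × ℝ =>
      ∫⁻ y : (ℝ ∙ (p.1 : E n))ᗮ, g (p.2 • (p.1 : E n) + (y : E n)) := by
  have h : ∀ p : sphere (0 : E n) 1 × ℝ, ‖(p.1 : E n)‖ = 1 := fun p => by simp
  simp_rw [fun p => lintegral_hyperplane_eq (h p) p.2 hg]
  have hi : Measurable ((Ioc (0 : ℝ) 1).indicator (1 : ℝ → ℝ≥0∞)) :=
    measurable_one.indicator measurableSet_Ioc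
  refine Measurable.lintegral_prod_right' (f := fun q : (sphere (0 : E n) 1 × ℝ) × E n =>
    (Ioc (0 : ℝ) 1).indicator 1 (inner ℝ (q.1.1 : E n) q.2) *
        g (q.1.2 • (q.1.1 : E n) + (q.2 - inner ℝ (q.1.1 : E n) q.2 • (q.1.1 : E n)))) ?_
  fun_prop

lemma lintegral_cylinderMeasure {g : E n → ℝ≥0∞} (hg : Measurable g) :
    ∫⁻ p, (∫⁻ y : (ℝ ∙ (p.1 : E n))ᗮ, g (p.2 • (p.1 : E n) + (y : E n))) ∂(cylinderMeasure n) =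
      (∫⁻ x, g x) * (volume : Measure (E n)).toSphere univ := by
  rw [cylinderMeasure, lintegral_prod _ (measurable_lintegral_hyperplane hg).aemeasurable]
  simp_rw [fun θ : sphere (0 : E n) 1 =>
    lintegral_hyperplanes (show ‖(θ : E n)‖ = 1 by simp) hg]
  rw [lintegral_const]

/-- A null set meets almost every hyperplane in a null set: apply `lintegral_cylinderMeasure` to the
indicator of a measurable null superset. -/
lemma ae_hyperplane_of_ae {p : E n → Prop} (hp : ∀ᵐ x, p x) :
    ∀ᵐ q ∂(cylinderMeasure n), ∀ᵐ y : (ℝ ∙ (q.1 : E n))ᗮ,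
      p (q.2 • (q.1 : E n) + (y : E n)) := by
  set N := toMeasurable volume {x | ¬ p x}
  have hN : MeasurableSet N := measurableSet_toMeasurable _ _
  have hN0 : volume N = 0 := by rw [measure_toMeasurable]; exact hp
  have hg : Measurable (N.indicator (1 : E n → ℝ≥0∞)) := measurable_one.indicator hN
  have h0 := lintegral_cylinderMeasure hg
  rw [lintegral_indicator_one hN, hN0, zero_mul,
    lintegral_eq_zero_iff (measurable_lintegral_hyperplane hg)] at h0
  filter_upwards [h0] with q hq
  have hq' := (lintegral_eq_zero_iff (f := fun y : (ℝ ∙ (q.1 : E n))ᗮ =>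
    N.indicator (1 : E n → ℝ≥0∞) (q.2 • (q.1 : E n) + (y : E n))) (by fun_prop)).1 hq
  filter_upwards [hq'] with y hy
  by_contra hpy
  have : q.2 • (q.1 : E n) + (y : E n) ∈ N := subset_toMeasurable _ _ hpy
  simp [indicator_of_mem this] at hy

lemma ae_integrable_hyperplane {ψ : E n → 𝕜} (hψ : Integrable ψ) :
    ∀ᵐ q ∂(cylinderMeasure n), Integrable fun y : (ℝ ∙ (q.1 : E n))ᗮ =>
      ψ (q.2 • (q.1 : E n) + (y : E n)) := by
  obtain ⟨φ, hφ, hae⟩ := hψ.aestronglyMeasurable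
  have hφi : Integrable φ := hψ.congr hae
  have hg : Measurable fun x => ‖φ x‖ₑ := hφ.measurable.enorm
  have hfin : ∫⁻ q, (∫⁻ y : (ℝ ∙ (q.1 : E n))ᗮ, ‖φ (q.2 • (q.1 : E n) + (y : E n))‖ₑ)
      ∂(cylinderMeasure n) ≠ ∞ := by
    rw [lintegral_cylinderMeasure hg]
    exact ENNReal.mul_ne_top hφi.2.ne (measure_ne_top _ _)
  filter_upwards [ae_lt_top (measurable_lintegral_hyperplane hg) hfin,
    ae_hyperplane_of_ae hae] with q hq hqe
  refine Integrable.congr ?_ (Filter.EventuallyEq.symm hqe)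
  exact ⟨(hφ.comp_measurable (by fun_prop)).aestronglyMeasurable, hq⟩

end Fubini

/-! ### Injectivity of the Radon transform on `L¹`. -/

section Injectivity

variable {n : ℕ}

open Complex in
/-- The Fourier slice theorem, on the rays where the Radon transform vanishes. -/
lemma integral_mul_exp_eq_zero {ψ : E n → ℝ} (hψ : Integrable ψ) {θ : E n} (hθ : ‖θ‖ = 1)
    (h0 : ∀ᵐ t, radon ψ θ t = 0) (σ : ℝ) :
    ∫ x, (ψ x : ℂ) * exp ((inner ℝ x (σ • θ) : ℝ) * I) = 0 := by
  have hm := measurePreserving_hyperplaneCoord hθ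
  have he := measurableEmbedding_hyperplaneCoord hθ
  have hint : Integrable fun x => (ψ x : ℂ) * exp ((inner ℝ x (σ • θ) : ℝ) * I) := by
    refine hψ.ofReal.mul_bdd (c := 1) (Continuous.aestronglyMeasurable (by fun_prop)) ?_
    exact ae_of_all _ fun x => (norm_exp_ofReal_mul_I _).le
  have hint' := (hm.integrable_comp_emb he).2 hint
  rw [← hm.integral_comp he, Measure.volume_eq_prod, integral_prod
    (fun p => (ψ (hyperplaneCoord θ p) : ℂ) *
      exp ((inner ℝ (hyperplaneCoord θ p) (σ • θ) : ℝ) * I)) hint']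
  refine integral_eq_zero_of_ae ?_
  filter_upwards [h0] with t ht
  -- The phase is constant on each hyperplane orthogonal to `θ`, so it leaves the inner integral.
  have hinner : ∀ y : (ℝ ∙ θ)ᗮ, inner ℝ (hyperplaneCoord θ (t, y)) (σ • θ) = σ * t := fun y => by
    rw [inner_smul_right, real_inner_comm, inner_hyperplaneCoord hθ]
  simp_rw [hinner]
  rw [integral_mul_const, integral_complex_ofReal]
  have : ∫ y : (ℝ ∙ θ)ᗮ, ψ (hyperplaneCoord θ (t, y)) = 0 := ht
  rw [this]
  simp

-- The positive and negative parts of `ψ` are densities of two finite measures with the same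
-- characteristic function, hence agree almost everywhere.
open Complex in
lemma ae_eq_zero_of_integral_mul_exp_eq_zero {ψ : E n → ℝ} (hψ : Integrable ψ)
    (h : ∀ ξ : E n, ∫ x, (ψ x : ℂ) * exp ((inner ℝ x ξ : ℝ) * I) = 0) : ψ =ᵐ[volume] 0 := by
  have hm : AEMeasurable ψ := hψ.aemeasurable
  -- `ENNReal.ofReal` truncates at zero: `μ ψ` has density `ψ⁺` and `μ (-ψ)` has density `ψ⁻`.
  let μ : (E n → ℝ) → Measure (E n) := fun φ => volume.withDensity fun x => ENNReal.ofReal (φ x)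
  have hfin : ∀ φ : E n → ℝ, Integrable φ → IsFiniteMeasure (μ φ) := fun φ hφ =>
    isFiniteMeasure_withDensity_ofReal hφ.2
  have hchar : ∀ φ : E n → ℝ, Integrable φ → ∀ ξ : E n, charFun (μ φ) ξ =
      ∫ x, ((max (φ x) 0 : ℝ) : ℂ) * exp ((inner ℝ x ξ : ℝ) * I) := fun φ hφ ξ => by
    rw [charFun_apply, integral_withDensity_eq_integral_toReal_smul₀
      hφ.aemeasurable.ennreal_ofReal (ae_of_all _ fun _ => ENNReal.ofReal_lt_top)]
    refine integral_congr_ae (ae_of_all _ fun x => ?_)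
    simp [ENNReal.toReal_ofReal']
  have hint : ∀ φ : E n → ℝ, Integrable φ → ∀ ξ : E n, Integrable fun x =>
      ((max (φ x) 0 : ℝ) : ℂ) * exp ((inner ℝ x ξ : ℝ) * I) := fun φ hφ ξ => by
    refine hφ.pos_part.ofReal.mul_bdd (c := 1) (Continuous.aestronglyMeasurable (by fun_prop)) ?_
    exact ae_of_all _ fun x => (norm_exp_ofReal_mul_I _).le
  have hfin1 := hfin ψ hψ
  have hfin2 := hfin (-ψ) hψ.neg
  have heq : μ ψ = μ (-ψ) := by
    refine Measure.ext_of_charFun (funext fun ξ => ?_)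
    rw [← sub_eq_zero, hchar ψ hψ, hchar (-ψ) hψ.neg, ← integral_sub (hint ψ hψ ξ)
      (hint (-ψ) hψ.neg ξ), ← h ξ]
    refine integral_congr_ae (ae_of_all _ fun x => ?_)
    simp only [← sub_mul, ← ofReal_sub, Pi.neg_apply]
    rw [max_zero_sub_max_neg_zero_eq_self]
  have hae := (withDensity_eq_iff hm.ennreal_ofReal hm.neg.ennreal_ofReal
    hψ.lintegral_lt_top.ne).1 heq
  filter_upwards [hae] with x hx
  have := congrArg ENNReal.toReal hx
  simp only [ENNReal.toReal_ofReal', Pi.neg_apply] at this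
  have h2 := max_zero_sub_max_neg_zero_eq_self (ψ x)
  simp only [Pi.zero_apply]
  linarith

-- The directions `θ` on whose whole line the Fourier transform vanishes form a closed set of full
-- surface measure, hence a dense one, hence the sphere. For `n = 0` the sphere is empty and the
-- claim fails.
open Complex in
lemma ae_eq_zero_of_radon_eq_zero [NeZero n] {ψ : E n → ℝ} (hψ : Integrable ψ)
    (h0 : ∀ᵐ p ∂(cylinderMeasure n), radon ψ (p.1 : E n) p.2 = 0) : ψ =ᵐ[volume] 0 := by
  refine ae_eq_zero_of_integral_mul_exp_eq_zero hψ ?_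
  set Ψ : E n → ℂ := fun ξ => ∫ x, (ψ x : ℂ) * exp ((inner ℝ x ξ : ℝ) * I)
  have hcont : Continuous Ψ := by
    refine continuous_of_dominated (bound := fun x => ‖ψ x‖) (fun ξ => ?_) (fun ξ => ?_) hψ.norm ?_
    · exact hψ.ofReal.aestronglyMeasurable.mul (Continuous.aestronglyMeasurable (by fun_prop))
    · refine ae_of_all _ fun x => ?_
      rw [norm_mul, norm_exp_ofReal_mul_I, mul_one, norm_real]
    · exact ae_of_all _ fun x => by fun_prop
  have hae : ∀ᵐ θ : sphere (0 : E n) 1 ∂(volume : Measure (E n)).toSphere, ∀ σ : ℝ, Ψ (σ • (θ : E n)) = 0 := by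
    have h1 : ∀ᵐ θ : sphere (0 : E n) 1 ∂(volume : Measure (E n)).toSphere, ∀ᵐ t : ℝ, radon ψ (θ : E n) t = 0 :=
      Measure.ae_ae_of_ae_prod h0
    filter_upwards [h1] with θ hθ σ
    exact integral_mul_exp_eq_zero hψ (by simp) hθ σ
  have hclosed : IsClosed {θ : sphere (0 : E n) 1 | ∀ σ : ℝ, Ψ (σ • (θ : E n)) = 0} := by
    have hset : {θ : sphere (0 : E n) 1 | ∀ σ : ℝ, Ψ (σ • (θ : E n)) = 0} =
        ⋂ σ : ℝ, {θ : sphere (0 : E n) 1 | Ψ (σ • (θ : E n)) = 0} := by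
      ext; simp
    rw [hset]
    exact isClosed_iInter fun σ => isClosed_eq (by fun_prop) continuous_const
  have hall : ∀ (θ : sphere (0 : E n) 1) (σ : ℝ), Ψ (σ • (θ : E n)) = 0 := fun θ =>
    by
    have := (Measure.dense_of_ae hae) θ
    rwa [hclosed.closure_eq] at this
  intro ξ
  obtain ⟨θ, hθ⟩ : ∃ θ : sphere (0 : E n) 1, ‖ξ‖ • (θ : E n) = ξ := by
    rcases eq_or_ne ξ 0 with rfl | hξ
    · obtain ⟨θ, hθ⟩ := (NormedSpace.sphere_nonempty (x := (0 : E n)) (r := 1)).2 zero_le_one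
      exact ⟨⟨θ, hθ⟩, by simp⟩
    · exact ⟨⟨‖ξ‖⁻¹ • ξ, by simp [norm_smul, hξ]⟩, smul_inv_smul₀ (norm_ne_zero_iff.2 hξ) _⟩
  rw [← hθ]
  exact hall θ _

/-- The hyperplane Radon transform is injective on `L¹(ℝⁿ)`. -/
theorem radon_injective [NeZero n] {ψ₁ ψ₂ : E n → 𝕜} (h₁ : Integrable ψ₁) (h₂ : Integrable ψ₂)
    (h : ∀ᵐ p ∂(cylinderMeasure n), radon ψ₁ (p.1 : E n) p.2 = radon ψ₂ (p.1 : E n) p.2) :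
    ψ₁ =ᵐ[volume] ψ₂ := by
  -- Real functionals, later the real and imaginary parts, reduce to real `ψ`. They and the
  -- difference pass through `radon` only where the hyperplane integrals converge.
  have hL : ∀ L : 𝕜 →L[ℝ] ℝ, (fun x => L (ψ₁ x - ψ₂ x)) =ᵐ[volume] 0 := fun L => by
    refine ae_eq_zero_of_radon_eq_zero (L.integrable_comp (h₁.sub h₂)) ?_
    filter_upwards [h, ae_integrable_hyperplane h₁, ae_integrable_hyperplane h₂] with p hp hp1 hp2
    have := L.integral_comp_comm (hp1.sub hp2)
    simp only [Pi.sub_apply] at this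
    rw [radon, this, integral_sub hp1 hp2]
    rw [radon, radon] at hp
    rw [hp, sub_self, map_zero]
  filter_upwards [hL RCLike.reCLM, hL RCLike.imCLM] with x hr hi
  refine sub_eq_zero.1 (RCLike.ext ?_ ?_)
  · simpa using hr
  · simpa using hi

end Injectivity

/-! ### Recovery of `f` from its slice transform. -/

lemma isRadonPreimage_flatten {n : ℕ} {f : E' n → 𝕜} (hf : Integrable f (hemisphereMeasure n)) :
    IsRadonPreimage (normalizedSlice f) (flatten f) :=
  ⟨(integrable_flatten_iff f).2 hf,
    ae_of_all _ fun p => (normalizedSlice_eq f (by simp) p.2).symm⟩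

/-- Injectivity makes the arbitrary choice inside `radonInv` immaterial. -/
lemma radonInv_ae_eq {n : ℕ} [NeZero n] {Φ : E n → ℝ → 𝕜} {ψ : E n → 𝕜}
    (h : IsRadonPreimage Φ ψ) : radonInv Φ =ᵐ[volume] ψ := by
  have hex : ∃ ψ, IsRadonPreimage Φ ψ := ⟨ψ, h⟩
  rw [radonInv, dif_pos hex]
  refine radon_injective hex.choose_spec.1 h.1 ?_
  filter_upwards [hex.choose_spec.2, h.2] with p h1 h2
  rw [h1, h2]

/-- Lebesgue-null sets of the ball lift to `σ`-null sets and the equator is `σ`-null; elsewhere the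
height is positive and cancels the weight in `flatten`. -/
lemma ae_hemisphere_eq_smul {n : ℕ} (f : E' n → 𝕜) {ψ : E n → 𝕜}
    (h : ψ =ᵐ[volume] flatten f) :
    ∀ᵐ x ∂(hemisphereMeasure n), f x = x.snd • ψ x.fst := by
  rw [hemisphereMeasure_eq, measurableEmbedding_lift.ae_map_iff, ballMeasure]
  refine (withDensity_absolutelyContinuous _ _).ae_le ?_
  filter_upwards [ae_restrict_mem measurableSet_ball, ae_restrict_of_ae h] with x hx hψ
  have hx1 : ‖x‖ < 1 := mem_ball_zero_iff.1 hx
  have hpos : 0 < 1 - ‖x‖ ^ 2 := sub_pos.2 ((sq_lt_one_iff₀ (norm_nonneg x)).2 hx1)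
  change f (lift x) = √(1 - ‖x‖ ^ 2) • ψ x
  rw [hψ, flatten, if_pos hx1, smul_inv_smul₀ (Real.sqrt_pos.2 hpos).ne', lift_eq_point]

end VerticalSlice

end

theorem theorem2p3 {𝕜 : Type*} [RCLike 𝕜] (n : ℕ) (hn : 2 ≤ n) :
    -- `R` is injective on `L¹(ℝⁿ)`, so that `R⁻¹` is well defined on the range of `R`
    (∀ ψ₁ ψ₂ : VerticalSlice.E n → 𝕜, Integrable ψ₁ → Integrable ψ₂ →
      (∀ᵐ p ∂(VerticalSlice.cylinderMeasure n),
        VerticalSlice.radon ψ₁ (p.1 : VerticalSlice.E n) p.2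
          = VerticalSlice.radon ψ₂ (p.1 : VerticalSlice.E n) p.2) →
      ψ₁ =ᵐ[volume] ψ₂) ∧
    ∀ f : VerticalSlice.E' n → 𝕜, Integrable f (VerticalSlice.hemisphereMeasure n) →
      -- `φ ∈ L¹`, and `V₊ f = √(1 - t²) R φ` almost everywhere on `Sⁿ⁻¹ × (-1, 1)`
      Integrable (VerticalSlice.flatten f) ∧
      (∀ᵐ p ∂(VerticalSlice.cylinderMeasure n), |p.2| < 1 →
        Integrable f (VerticalSlice.sliceMeasure (p.1 : VerticalSlice.E n) p.2) ∧
        Integrable (fun y : (ℝ ∙ (p.1 : VerticalSlice.E n))ᗮ =>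
          VerticalSlice.flatten f (p.2 • (p.1 : VerticalSlice.E n) + (y : VerticalSlice.E n))) ∧
        VerticalSlice.sliceTransform f (p.1 : VerticalSlice.E n) p.2
          = √(1 - p.2 ^ 2) •
            VerticalSlice.radon (VerticalSlice.flatten f) (p.1 : VerticalSlice.E n) p.2) ∧
      -- and everywhere there if `f` is continuous on the hemisphere
      (ContinuousOn f (VerticalSlice.hemisphere n) →
        ∀ (θ : VerticalSlice.E n) (t : ℝ), ‖θ‖ = 1 → |t| < 1 →
          Integrable f (VerticalSlice.sliceMeasure θ t) ∧
          Integrable (fun y : (ℝ ∙ θ)ᗮ =>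
            VerticalSlice.flatten f (t • θ + (y : VerticalSlice.E n))) ∧
          VerticalSlice.sliceTransform f θ t
            = √(1 - t ^ 2) • VerticalSlice.radon (VerticalSlice.flatten f) θ t) ∧
      -- `Φ` lies in the range of `R`, and `f(x', xₙ₊₁) = xₙ₊₁ (R⁻¹ Φ)(x')`
      (∃ ψ, VerticalSlice.IsRadonPreimage (VerticalSlice.normalizedSlice f) ψ) ∧
      (∀ᵐ x ∂(VerticalSlice.hemisphereMeasure n),
        f x = x.snd • VerticalSlice.radonInv (VerticalSlice.normalizedSlice f) x.fst) := by
  have : NeZero n := ⟨by omega⟩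
  refine ⟨fun ψ₁ ψ₂ h₁ h₂ h => VerticalSlice.radon_injective h₁ h₂ h, fun f hf => ?_⟩
  have hφ := (VerticalSlice.integrable_flatten_iff f).2 hf
  have hpre := VerticalSlice.isRadonPreimage_flatten hf
  refine ⟨hφ, ?_, fun hc θ t hθ ht => ?_, ⟨_, hpre⟩,
    VerticalSlice.ae_hemisphere_eq_smul f (VerticalSlice.radonInv_ae_eq hpre)⟩
  -- Only convergence needs "almost every": the identity holds on every slice, since a divergent
  -- Bochner integral is `0` on both sides.
  · filter_upwards [VerticalSlice.ae_integrable_hyperplane hφ] with p hp ht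
    have hθ : ‖(p.1 : VerticalSlice.E n)‖ = 1 := by simp
    exact ⟨(VerticalSlice.integrable_sliceMeasure_iff f hθ ht).2 hp, hp,
      VerticalSlice.sliceTransform_eq f hθ ht⟩
  · have hi := VerticalSlice.integrable_sliceMeasure_of_continuousOn hc hθ ht
    exact ⟨hi, (VerticalSlice.integrable_sliceMeasure_iff f hθ ht).1 hi,
      VerticalSlice.sliceTransform_eq f hθ ht⟩
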